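/- For $d\ge 1$ let $\lambda_d$ denote the smallest eigenvalue of the Dirichlet Laplace operator $-\Delta$ on the ball $B_{1/2}(0)\subset\mathbb R^d$, that is, the infimum of $\int\|\nabla u\|^2\,dx\big/\int u^2\,dx$ over all nonzero $u\in C_c^\infty(B_{1/2}(0))$, and put $$c_0:=\sqrt{2\lambda_d},\qquad c_1:=\frac{\pi^{d/2}}{2\lambda_d^{d/2}} .$$ These constants depend only on $d$. **Theorem.** Let $d\ge 1$. Then $c_0,c_1>0$, and the following holds. Let $\Phi\in L^1(\mathbb R^d)$ be real-valued, such that $k(x,z)=\Phi(x-z)$ is a positive definite kernel, i.e. for every finite set $Y\subset\mathbb R^d$ the kernel matrix $k(Y,Y)=(k(x,z))_{x,z\in Y}$ is symmetric and positive semidefinite. Let $\hat\Phi(\omega)=(2\pi)^{-d/2}\int_{\mathbb R^d}\Phi(x)e^{-i\omega^\top x}\,dx$ be the (real-valued, continuous) Fourier transform of $\Phi$. Then for every finite set $X\subset\mathbb R^d$ of at least two pairwise distinct points, with separation distance $q_X=\min_{x\neq y\in X}\|x-y\|$, the smallest eigenvalue of the kernel matrix $A=k(X,X)$ satisfies $$\lambda_{\min}(A)\;\ge\;\frac{c_0^d\,c_1}{(2\pi)^{d/2}}\cdot\Big(\min_{\|\omega\|\le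 c_0/q_X}\hat\Phi(\omega)\Big)\cdot q_X^{-d}.$$ -/

import Mathlib

open MeasureTheory Metric

noncomputable section

/-- The kernel matrix `k(X, X) = (k(x, z))_{x, z ∈ X}` of a finite set `X` of (automatically
pairwise distinct) points. -/
def kernelMatrix {E : Type*} (k : E → E → ℝ) (X : Finset E) : Matrix X X ℝ :=
  Matrix.of fun x z => k x z

/-- `k` is a positive definite kernel: all its kernel matrices are symmetric and positive
semidefinite (strict definiteness is not required). -/
def IsPosDefKernel {E : Type*} (k : E → E → ℝ) : Prop :=
  ∀ X : Finset E, (kernelMatrix k X).PosSemidef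

/-- The translational invariant kernel `k(x, z) = Φ(x - z)`. -/
def translationKernel {E : Type*} [AddCommGroup E] (Φ : E → ℝ) : E → E → ℝ :=
  fun x z => Φ (x - z)

/-- The smallest eigenvalue of a real square matrix. -/
def lambdaMin {ι : Type*} [Fintype ι] [DecidableEq ι] (A : Matrix ι ι ℝ) : ℝ :=
  sInf {μ : ℝ | Module.End.HasEigenvalue (Matrix.toLin' A) μ}

/-- The Fourier transform in the unitary normalization,
`Φ̂(ξ) = (2π)^{-d/2} ∫ Φ(x) e^{-i ξ·x} dx`. -/
def unitaryFourier {d : ℕ} (Φ : EuclideanSpace ℝ (Fin d) → ℝ)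
    (ξ : EuclideanSpace ℝ (Fin d)) : ℂ :=
  (((2 * Real.pi) ^ (-(d : ℝ) / 2) : ℝ) : ℂ) *
    ∫ x, (Φ x : ℂ) * Complex.exp (-Complex.I * (inner ℝ ξ x : ℝ))

/-- For an even function, as is the profile of every symmetric translational invariant kernel,
the Fourier transform is real, so that nothing is lost by taking its real part. -/
theorem unitaryFourier_im_eq_zero {d : ℕ} (Φ : EuclideanSpace ℝ (Fin d) → ℝ)
    (hΦ : ∀ x, Φ (-x) = Φ x) (ξ : EuclideanSpace ℝ (Fin d)) :
    (unitaryFourier Φ ξ).im = 0 := by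
  rw [← Complex.conj_eq_iff_im]
  unfold unitaryFourier
  rw [map_mul, Complex.conj_ofReal, ← integral_conj]
  congr 1
  rw [← integral_neg_eq_self]
  refine integral_congr_ae (Filter.Eventually.of_forall fun x => ?_)
  simp only [map_mul, Complex.conj_ofReal, ← Complex.exp_conj, map_neg, Complex.conj_I, hΦ,
    inner_neg_right, Complex.ofReal_neg]
  congr 2
  ring

/-- `min_{‖ξ‖ ≤ r} Φ̂(ξ)` for a real-valued Fourier transform `Φ̂`. It is a minimum, because `Φ̂` is
continuous for integrable `Φ` and the closed ball is compact. -/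
def minFourierOnBall {d : ℕ} (Φ : EuclideanSpace ℝ (Fin d) → ℝ) (r : ℝ) : ℝ :=
  sInf ((fun ξ => (unitaryFourier Φ ξ).re) '' closedBall (0 : EuclideanSpace ℝ (Fin d)) r)

/-- The smallest eigenvalue of the Dirichlet Laplace operator `-Δ` on the ball `B_{1/2}(0)` of
`ℝ^d`: the infimum of the Rayleigh quotient `∫ ‖∇u‖² / ∫ u²` over the nonzero smooth functions
with compact support in the open ball (a form core of the Dirichlet Laplacian). -/
def dirichletEigenvalue (d : ℕ) : ℝ :=
  sInf {r : ℝ | ∃ u : EuclideanSpace ℝ (Fin d) → ℝ,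
    ContDiff ℝ (⊤ : ℕ∞) u ∧ HasCompactSupport u ∧
    tsupport u ⊆ ball (0 : EuclideanSpace ℝ (Fin d)) (1 / 2) ∧ u ≠ 0 ∧
    r = (∫ x, ‖gradient u x‖ ^ 2) / ∫ x, u x ^ 2}

/-- `c₀ = √2 λ^{1/2}` with `λ` the smallest Dirichlet eigenvalue. -/
def constZero (d : ℕ) : ℝ := √2 * √(dirichletEigenvalue d)

/-- `c₁ = π^{d/2} / (2 λ^{d/2})` with `λ` the smallest Dirichlet eigenvalue. -/
def constOne (d : ℕ) : ℝ :=
  Real.pi ^ ((d : ℝ) / 2) / (2 * dirichletEigenvalue d ^ ((d : ℝ) / 2))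

end

/-! Write F for the Fourier transform of Φ with character exp(-2πi⟪x, w⟫) and P for the exponential
sum with weights a and frequencies X. The function τ ↦ ∑ aᵢaⱼ Φ(xᵢ - xⱼ + τ) is again positive
definite, has transform F|P|², and equals aᵀAa at 0. A nonnegative transform has mass at most the
value at 0 on every ball, so aᵀAa ≥ ∫_B F|P|² (`IsPosDefFun.setIntegral_re_fourier_mul_expSum_le`).
This inequality replaces Bochner's theorem: neither continuity of Φ nor integrability of F is
needed.

It remains to bound ∫_B |P|² below, an Ingham inequality (`sum_sq_le_setIntegral_expSum`). For
1-separated nodes, the translates of a test function u supported in the ball of radius 1/2 are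
disjoint. Plancherel then gives ∫|P|²|û|² = ∑aᵢ² ∫u², and likewise with |2πw|²|û|² and ∫‖∇u‖².
Subtracting the second from c² times the first leaves a weight that is negative outside B = {|2πw| ≤
c}. Taking u nearly optimal for the Dirichlet Rayleigh quotient and c² = 2λ yields ∑aᵢ²/4 ≤ ∫_B
|P|²; scaling handles general q. -/

open scoped FourierTransform RealInnerProductSpace

/-! ### Positive definite functions. -/

/-- `Φ` is a positive definite function: it is even, and all its quadratic forms, possibly with
repeated nodes, are nonnegative. -/
structure IsPosDefFun {V : Type*} [AddCommGroup V] (Φ : V → ℝ) : Prop where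
  even : ∀ x, Φ (-x) = Φ x
  nonneg : ∀ (ι : Type) [Fintype ι] (c : ι → ℝ) (z : ι → V),
    0 ≤ ∑ i, ∑ j, c i * c j * Φ (z i - z j)

/-- Repeated nodes are harmless: pulling back a positive semidefinite matrix along a map of indices,
injective or not, keeps it positive semidefinite. -/
theorem IsPosDefKernel.isPosDefFun {V : Type*} [AddCommGroup V] {Φ : V → ℝ}
    (h : IsPosDefKernel (translationKernel Φ)) : IsPosDefFun Φ where
  even x := by
    classical
    have := (h {0, x}).isHermitian.apply ⟨0, by simp⟩ ⟨x, by simp⟩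
    simpa [kernelMatrix, translationKernel] using this.symm
  nonneg ι _ c z := by
    classical
    have h1 := (h (Finset.univ.image z)).submatrix
      (fun i : ι => (⟨z i, by simp⟩ : (Finset.univ.image z : Finset V)))
    have h2 := h1.dotProduct_mulVec_nonneg c
    simp only [dotProduct, Matrix.mulVec, Finset.mul_sum] at h2
    refine h2.trans_eq (Finset.sum_congr rfl fun i _ => Finset.sum_congr rfl fun j _ => ?_)
    simp [kernelMatrix, translationKernel]
    ring

namespace IsPosDefFun

variable {V : Type*}

/-- Two nodes x and 0 with weights 1 and ±1. -/
theorem abs_le [AddCommGroup V] {Φ : V → ℝ} (h : IsPosDefFun Φ) (x : V) : |Φ x| ≤ Φ 0 := by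
  have h1 := h.nonneg (Fin 2) ![1, 1] ![x, 0]
  have h2 := h.nonneg (Fin 2) ![1, -1] ![x, 0]
  simp [Fin.sum_univ_two, h.even] at h1 h2
  rw [_root_.abs_le]
  constructor <;> linarith

/-- Multiplication by a cosine preserves positive definiteness. -/
theorem mul_cos [NormedAddCommGroup V] [InnerProductSpace ℝ V] {Φ : V → ℝ} (h : IsPosDefFun Φ)
    (ξ : V) : IsPosDefFun fun x => Φ x * Real.cos (⟪ξ, x⟫) where
  even x := by simp [h.even]
  nonneg ι _ c z := by
    have h1 := h.nonneg ι (fun i => c i * Real.cos ⟪ξ, z i⟫) z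
    have h2 := h.nonneg ι (fun i => c i * Real.sin ⟪ξ, z i⟫) z
    refine (add_nonneg h1 h2).trans_eq ?_
    simp only [← Finset.sum_add_distrib]
    refine Finset.sum_congr rfl fun i _ => Finset.sum_congr rfl fun j _ => ?_
    rw [inner_sub_right, Real.cos_sub]
    ring

/-- The correlations of a positive definite function with a discrete measure. -/
theorem sum_sum [AddCommGroup V] {Φ : V → ℝ} (h : IsPosDefFun Φ) {κ : Type} [Fintype κ]
    (a : κ → ℝ) (x : κ → V) :
    IsPosDefFun fun τ => ∑ i, ∑ j, a i * a j * Φ (x i - x j + τ) where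
  even τ := by
    rw [Finset.sum_comm]
    refine Finset.sum_congr rfl fun i _ => Finset.sum_congr rfl fun j _ => ?_
    rw [← h.even, mul_comm (a j)]
    congr 2
    abel
  nonneg ι _ c z := by
    -- The nodes z i + x k may coincide; this is why repeated nodes are allowed.
    have h1 := h.nonneg (ι × κ) (fun p => c p.1 * a p.2) (fun p => z p.1 + x p.2)
    refine h1.trans_eq ?_
    simp only [Fintype.sum_prod_type, Finset.mul_sum]
    refine Finset.sum_congr rfl fun i _ => ?_
    rw [Finset.sum_comm]
    refine Finset.sum_congr rfl fun j _ => Finset.sum_congr rfl fun k _ =>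
      Finset.sum_congr rfl fun l _ => ?_
    rw [show z i + x k - (z j + x l) = x k - x l + (z i - z j) by abel]
    ring

variable [NormedAddCommGroup V] [MeasurableSpace V] [BorelSpace V]
  [SecondCountableTopology V]

/-- Φ is only a.e. strongly measurable, so absolute continuity of μ is what makes the composition
with subtraction measurable. -/
theorem integrable_comp_sub {Φ : V → ℝ} (h : IsPosDefFun Φ) {ν : Measure V} [SigmaFinite ν]
    [ν.IsAddLeftInvariant] [ν.IsAddRightInvariant]
    (hm : AEStronglyMeasurable Φ ν) {μ : Measure V} [IsProbabilityMeasure μ] (hμ : μ ≪ ν) :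
    Integrable (fun p : V × V => Φ (p.1 - p.2)) (μ.prod μ) := by
  have hq := quasiMeasurePreserving_sub_of_right_invariant ν ν
  have h1 : AEStronglyMeasurable (fun p : V × V => Φ (p.1 - p.2)) (μ.prod μ) :=
    (hm.comp_quasiMeasurePreserving hq).mono_ac (hμ.prod hμ)
  exact Integrable.of_bound h1 (Φ 0) (Filter.Eventually.of_forall fun p => h.abs_le _)

/-- Testing a positive definite function with random nodes. -/
theorem integral_prod_nonneg {Φ : V → ℝ} (h : IsPosDefFun Φ) {ν : Measure V} [SigmaFinite ν]
    [ν.IsAddLeftInvariant] [ν.IsAddRightInvariant]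
    (hm : AEStronglyMeasurable Φ ν) {μ : Measure V} [IsProbabilityMeasure μ] (hμ : μ ≪ ν) :
    0 ≤ ∫ p : V × V, Φ (p.1 - p.2) ∂(μ.prod μ) := by
  set I := ∫ p : V × V, Φ (p.1 - p.2) ∂(μ.prod μ) with hI
  have hint := h.integrable_comp_sub hm hμ
  -- Draw N independent nodes with law μ. The expected quadratic form with unit weights has N
  -- diagonal terms Φ 0 and N(N-1) off-diagonal terms I. Dividing by N² and letting N grow excludes
  -- I < 0.
  have key (N : ℕ) : 0 ≤ N * (Φ 0 - I) + N * N * I := by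
    set ρ := Measure.pi (fun _ : Fin N => μ)
    have hind : ProbabilityTheory.iIndepFun (fun (i : Fin N) (t : Fin N → V) => t i) ρ :=
      ProbabilityTheory.iIndepFun_pi (X := fun _ => id) (fun _ => aemeasurable_id)
    have hmp (i : Fin N) : MeasurePreserving (fun t : Fin N → V => t i) ρ μ :=
      measurePreserving_eval _ i
    have hpair (i j : Fin N) (hij : i ≠ j) :
        MeasurePreserving (fun t : Fin N → V => (t i, t j)) ρ (μ.prod μ) := by
      refine ⟨by fun_prop, ?_⟩
      rw [(ProbabilityTheory.indepFun_iff_map_prod_eq_prod_map_map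
        (measurable_pi_apply i).aemeasurable (measurable_pi_apply j).aemeasurable).1 (hind.indepFun hij), (hmp i).map_eq, (hmp j).map_eq]
    have hi (i j : Fin N) : Integrable (fun t : Fin N → V => Φ (t i - t j)) ρ := by
      by_cases hij : i = j
      · subst hij; simp
      · exact (hpair i j hij).integrable_comp_of_integrable hint
    have hv (i j : Fin N) : ∫ t : Fin N → V, Φ (t i - t j) ∂ρ =
        (if i = j then Φ 0 - I else 0) + I := by
      split_ifs with hij
      · subst hij; simp
      · rw [zero_add, hI, ← (hpair i j hij).map_eq, integral_map (by fun_prop)]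
        rw [(hpair i j hij).map_eq]
        exact hint.1
    have h0 : 0 ≤ ∫ t : Fin N → V, ∑ i, ∑ j, Φ (t i - t j) ∂ρ :=
      integral_nonneg fun t => by simpa using h.nonneg (Fin N) (fun _ => 1) t
    rw [integral_finsetSum _ fun i _ => integrable_finsetSum _ fun j _ => hi i j] at h0
    simp_rw [integral_finsetSum _ fun j _ => hi _ j, hv] at h0
    simpa [Finset.sum_add_distrib, mul_add, mul_assoc, add_mul] using h0
  by_contra! hneg
  obtain ⟨N, hN⟩ := exists_nat_gt ((Φ 0 - I) / (-I))
  rw [div_lt_iff₀ (by linarith)] at hN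
  have hΦ : 0 ≤ Φ 0 := (abs_nonneg _).trans (h.abs_le 0)
  have hN0 : (0 : ℝ) < N := by
    rcases Nat.eq_zero_or_pos N with rfl | hp
    · simp at hN; linarith
    · exact_mod_cast hp
  nlinarith [key N]

end IsPosDefFun

/-! ### Gaussians and the Fourier transform of a positive definite function. -/

section Gaussian

variable {V : Type*} [NormedAddCommGroup V] [InnerProductSpace ℝ V] [FiniteDimensional ℝ V]
  [MeasurableSpace V] [BorelSpace V]

theorem integral_exp_neg_mul_sq_norm_pos {b : ℝ} (hb : 0 < b) :
    0 < ∫ v : V, Real.exp (-b * ‖v‖ ^ 2) := by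
  rw [GaussianFourier.integral_rexp_neg_mul_sq_norm hb]
  have := Real.pi_pos
  positivity

theorem integrable_exp_neg_mul_sq_norm {b : ℝ} (hb : 0 < b) :
    Integrable (fun v : V => Real.exp (-b * ‖v‖ ^ 2)) :=
  -- A nonintegrable function has integral 0 by convention, so a nonzero integral forces
  -- integrability.
  not_imp_comm.1 integral_undef (integral_exp_neg_mul_sq_norm_pos hb).ne'

end Gaussian

/-- The real part of the Fourier transform of a real function is its cosine transform. -/
theorem re_fourier_ofReal {V : Type*} [NormedAddCommGroup V] [InnerProductSpace ℝ V]
    [FiniteDimensional ℝ V] [MeasurableSpace V] [BorelSpace V] {Φ : V → ℝ} (hΦ : Integrable Φ)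
    (w : V) :
    (𝓕 (fun x => (Φ x : ℂ)) w).re = ∫ x, Φ x * Real.cos ⟪(2 * Real.pi) • w, x⟫ := by
  have hi : Integrable fun x => Real.fourierChar (-⟪x, w⟫) • (Φ x : ℂ) :=
    (Real.fourierIntegral_convergent_iff w).2 hΦ.ofReal
  rw [Real.fourier_eq, ← RCLike.re_eq_complex_re, ← integral_re hi]
  refine integral_congr_ae (Filter.Eventually.of_forall fun x => ?_)
  simp only [RCLike.re_eq_complex_re, Circle.smul_def, Real.fourierChar_apply, smul_eq_mul,
    Complex.re_mul_ofReal]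
  rw [Complex.exp_ofReal_mul_I_re, mul_comm, ← Real.cos_neg, inner_smul_left, real_inner_comm]
  simp

namespace IsPosDefFun

variable {V : Type*} [NormedAddCommGroup V] [InnerProductSpace ℝ V] [FiniteDimensional ℝ V]
  [MeasurableSpace V] [BorelSpace V] {Φ : V → ℝ}

theorem integral_prod_mul_nonneg (h : IsPosDefFun Φ) (hm : AEStronglyMeasurable Φ)
    {q : V → ℝ} (hq : Continuous q) (hq0 : ∀ x, 0 ≤ q x) (hq1 : ∫ x, q x = 1) :
    0 ≤ ∫ p : V × V, q p.1 * q p.2 * Φ (p.1 - p.2) := by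
  have hqi : Integrable q := not_imp_comm.1 integral_undef (by simp [hq1])
  set μ : Measure V := volume.withDensity fun x => ENNReal.ofReal (q x) with hμ
  have : IsProbabilityMeasure μ := ⟨by
    rw [hμ, withDensity_apply _ MeasurableSet.univ, Measure.restrict_univ,
      ← ofReal_integral_eq_lintegral_ofReal hqi (Filter.Eventually.of_forall hq0), hq1]
    simp⟩
  have h1 := h.integral_prod_nonneg hm (μ := μ) (withDensity_absolutelyContinuous _ _)
  have hqm := hq.measurable
  rw [hμ, prod_withDensity (by fun_prop) (by fun_prop),
    integral_withDensity_eq_integral_toReal_smul (by fun_prop)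
      (Filter.Eventually.of_forall fun x => ENNReal.mul_lt_top ENNReal.ofReal_lt_top
        ENNReal.ofReal_lt_top)] at h1
  refine h1.trans_eq (integral_congr_ae (Filter.Eventually.of_forall fun p => ?_))
  simp [ENNReal.toReal_ofReal, hq0]

/-- The autocorrelation of a Gaussian is a Gaussian: testing with random nodes of density
proportional to exp(-2b‖x‖²) produces the weight exp(-b‖τ‖²) on differences τ. -/
theorem integral_mul_gaussian_nonneg (h : IsPosDefFun Φ) (hi : Integrable Φ) {b : ℝ}
    (hb : 0 < b) : 0 ≤ ∫ x, Φ x * Real.exp (-b * ‖x‖ ^ 2) := by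
  set Z := ∫ x : V, Real.exp (-(2 * b) * ‖x‖ ^ 2) with hZ
  have hZ0 : 0 < Z := integral_exp_neg_mul_sq_norm_pos (by positivity)
  set q : V → ℝ := fun x => Z⁻¹ * Real.exp (-(2 * b) * ‖x‖ ^ 2) with hq
  have hqc : Continuous q := by fun_prop
  have hq0 (x : V) : 0 ≤ q x := by positivity
  have hqi : Integrable q := (integrable_exp_neg_mul_sq_norm (by positivity)).const_mul _
  have hq1 : ∫ x, q x = 1 := by
    rw [integral_const_mul, ← hZ, inv_mul_cancel₀ hZ0.ne']
  have hqb (x : V) : ‖q x‖ ≤ Z⁻¹ := by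
    rw [Real.norm_of_nonneg (hq0 x)]
    refine mul_le_of_le_one_right (by positivity) (Real.exp_le_one_iff.2 ?_)
    have : 0 ≤ 2 * b * ‖x‖ ^ 2 := by positivity
    linarith
  have h1 := h.integral_prod_mul_nonneg hi.1 hqc hq0 hq1
  -- Shear to the variables (t, τ), the second node being t + τ.
  have hmp := measurePreserving_prod_add (volume : Measure V) (volume : Measure V)
  have hme : MeasurableEmbedding fun z : V × V => (z.1, z.1 + z.2) :=
    (MeasurableEquiv.shearAddRight V).measurableEmbedding
  rw [Measure.volume_eq_prod, ← hmp.integral_comp hme] at h1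
  have hint : Integrable (fun p : V × V => q p.1 * q (p.1 + p.2) * Φ p.2)
      ((volume : Measure V).prod (volume : Measure V)) := by
    have := (hqi.mul_prod hi).bdd_mul (c := Z⁻¹)
      (f := fun p : V × V => q (p.1 + p.2)) (by fun_prop : Continuous _).aestronglyMeasurable
      (Filter.Eventually.of_forall fun p => hqb _)
    exact this.congr (Filter.Eventually.of_forall fun p => by ring)
  have hinner (τ : V) : ∫ t, q t * q (t + τ) * Φ τ =
      (Z⁻¹ ^ 2 * ∫ t : V, Real.exp (-(4 * b) * ‖t‖ ^ 2)) * (Φ τ * Real.exp (-b * ‖τ‖ ^ 2)) := by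
    rw [← integral_add_right_eq_self (μ := (volume : Measure V))
      (fun t : V => Real.exp (-(4 * b) * ‖t‖ ^ 2)) ((1 / 2 : ℝ) • τ), ← integral_const_mul,
      ← integral_mul_const]
    refine integral_congr_ae (Filter.Eventually.of_forall fun t => ?_)
    -- Completing the square around the midpoint separates t from τ.
    have : Real.exp (-(2 * b) * ‖t‖ ^ 2) * Real.exp (-(2 * b) * ‖t + τ‖ ^ 2) =
        Real.exp (-(4 * b) * ‖t + (1 / 2 : ℝ) • τ‖ ^ 2) * Real.exp (-b * ‖τ‖ ^ 2) := by
      rw [← Real.exp_add, ← Real.exp_add, norm_add_sq_real, norm_add_sq_real, norm_smul,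
        inner_smul_right]
      congr 1
      norm_num
      ring
    simp only [hq]
    linear_combination (Z⁻¹ ^ 2 * Φ τ) * this
  have h2 : 0 ≤ ∫ p : V × V, q p.1 * q (p.1 + p.2) * Φ p.2
      ∂((volume : Measure V).prod (volume : Measure V)) := by
    refine h1.trans_eq (integral_congr_ae (Filter.Eventually.of_forall fun p => ?_))
    simp [h.even]
  rw [integral_prod_symm _ hint] at h2
  simp_rw [hinner] at h2
  rw [integral_const_mul] at h2
  refine nonneg_of_mul_nonneg_right h2 ?_
  have := integral_exp_neg_mul_sq_norm_pos (V := V) (b := 4 * b) (by positivity)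
  positivity

/-- Let the Gaussian weight tend to 1, dominated by |Φ|. -/
theorem integral_nonneg (h : IsPosDefFun Φ) (hi : Integrable Φ) : 0 ≤ ∫ x, Φ x := by
  have hlim : Filter.Tendsto (fun n : ℕ => ∫ x, Φ x * Real.exp (-(1 / ((n : ℝ) + 1)) * ‖x‖ ^ 2))
      Filter.atTop (nhds (∫ x, Φ x)) := by
    refine tendsto_integral_of_dominated_convergence (fun x => ‖Φ x‖)
      (fun n => hi.1.mul (by fun_prop : Continuous _).aestronglyMeasurable) hi.norm ?_ ?_
    · refine fun n => Filter.Eventually.of_forall fun x => ?_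
      rw [norm_mul, Real.norm_of_nonneg (Real.exp_pos _).le]
      refine mul_le_of_le_one_right (norm_nonneg _) (Real.exp_le_one_iff.2 ?_)
      have : 0 ≤ (1 / ((n : ℝ) + 1)) * ‖x‖ ^ 2 := by positivity
      linarith
    · refine Filter.Eventually.of_forall fun x => ?_
      have h1 : Filter.Tendsto (fun n : ℕ => Φ x * Real.exp (-(1 / ((n : ℝ) + 1)) * ‖x‖ ^ 2))
          Filter.atTop (nhds (Φ x * Real.exp (-0 * ‖x‖ ^ 2))) :=
        ((Real.continuous_exp.tendsto _).comp
          ((tendsto_one_div_add_atTop_nhds_zero_nat.neg).mul_const _)).const_mul _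
      simpa using h1
  exact ge_of_tendsto' hlim fun n => h.integral_mul_gaussian_nonneg hi (by positivity)

/-- The Fourier transform of an integrable positive definite function is nonnegative. -/
theorem re_fourier_nonneg (h : IsPosDefFun Φ) (hi : Integrable Φ) (w : V) :
    0 ≤ (𝓕 (fun x => (Φ x : ℂ)) w).re := by
  rw [re_fourier_ofReal hi]
  refine (h.mul_cos _).integral_nonneg (hi.mul_bdd (c := 1)
    (by fun_prop : Continuous _).aestronglyMeasurable (Filter.Eventually.of_forall fun x => ?_))
  exact Real.abs_cos_le_one _

theorem continuous_fourier_ofReal (hi : Integrable Φ) : Continuous (𝓕 (fun x => (Φ x : ℂ))) :=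
  VectorFourier.fourierIntegral_continuous Real.continuous_fourierChar
    (by exact continuous_inner) hi.ofReal

/-- Moving the transform onto the Gaussian turns the left side into the mean of Φ under a Gaussian
probability density, and Φ ≤ Φ 0. -/
theorem integral_re_fourier_mul_gaussian_le (h : IsPosDefFun Φ) (hi : Integrable Φ) {b : ℝ}
    (hb : 0 < b) :
    ∫ w, (𝓕 (fun x => (Φ x : ℂ)) w).re * Real.exp (-b * ‖w‖ ^ 2) ≤ Φ 0 := by
  have hπ := Real.pi_pos
  set n : ℝ := Module.finrank ℝ V / 2 with hn
  have hg : Integrable (fun w : V => ((Real.exp (-b * ‖w‖ ^ 2) : ℝ) : ℂ)) :=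
    (integrable_exp_neg_mul_sq_norm hb).ofReal
  have hFb (w : V) : ‖𝓕 (fun x => (Φ x : ℂ)) w‖ ≤ ∫ x, ‖(Φ x : ℂ)‖ :=
    VectorFourier.norm_fourierIntegral_le_integral_norm _ _ _ _ _
  have hFg (x : V) : 𝓕 (fun w : V => ((Real.exp (-b * ‖w‖ ^ 2) : ℝ) : ℂ)) x =
      (((Real.pi / b) ^ n * Real.exp (-(Real.pi ^ 2 / b) * ‖x‖ ^ 2) : ℝ) : ℂ) := by
    have := fourier_gaussian_innerProductSpace (V := V) (b := (b : ℂ)) (by simpa) x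
    push_cast
    rw [this, Complex.ofReal_cpow (by positivity), hn]
    push_cast
    congr 2
    ring
  have hflip : ∫ w, 𝓕 (fun x => (Φ x : ℂ)) w * ((Real.exp (-b * ‖w‖ ^ 2) : ℝ) : ℂ) =
      ∫ x, (Φ x : ℂ) * 𝓕 (fun w : V => ((Real.exp (-b * ‖w‖ ^ 2) : ℝ) : ℂ)) x := by
    simpa using! VectorFourier.integral_fourierIntegral_smul_eq_flip (L := innerₗ V)
      Real.continuous_fourierChar continuous_inner hi.ofReal (𝕜 := ℝ) hg
  have hint : Integrable fun w =>
      𝓕 (fun x => (Φ x : ℂ)) w * ((Real.exp (-b * ‖w‖ ^ 2) : ℝ) : ℂ) :=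
    hg.bdd_mul (continuous_fourier_ofReal hi).aestronglyMeasurable
      (Filter.Eventually.of_forall hFb)
  have hre : ∫ w, (𝓕 (fun x => (Φ x : ℂ)) w).re * Real.exp (-b * ‖w‖ ^ 2) =
      ∫ x, Φ x * ((Real.pi / b) ^ n * Real.exp (-(Real.pi ^ 2 / b) * ‖x‖ ^ 2)) := by
    have h1 := integral_re hint
    simp only [RCLike.re_eq_complex_re, Complex.re_mul_ofReal] at h1
    rw [h1, hflip]
    simp_rw [hFg, ← Complex.ofReal_mul]
    rw [integral_complex_ofReal, Complex.ofReal_re]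
  rw [hre]
  have hb' : 0 < Real.pi ^ 2 / b := by positivity
  calc _ ≤ ∫ x : V, Φ 0 * ((Real.pi / b) ^ n * Real.exp (-(Real.pi ^ 2 / b) * ‖x‖ ^ 2)) := by
        have hG := (integrable_exp_neg_mul_sq_norm (V := V) hb').const_mul ((Real.pi / b) ^ n)
        refine integral_mono (hG.bdd_mul hi.1 (c := Φ 0)
          (Filter.Eventually.of_forall fun x => h.abs_le x)) (hG.const_mul _) fun x => ?_
        exact mul_le_mul_of_nonneg_right ((le_abs_self _).trans (h.abs_le x)) (by positivity)
    _ = Φ 0 := by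
        rw [integral_const_mul, integral_const_mul,
          GaussianFourier.integral_rexp_neg_mul_sq_norm hb', ← hn,
          ← Real.mul_rpow (by positivity) (by positivity)]
        rw [show Real.pi / b * (Real.pi / (Real.pi ^ 2 / b)) = 1 by field_simp]
        simp

/-- The Fourier transform of an integrable positive definite function has mass at most `Φ 0`
on every ball. -/
theorem setIntegral_re_fourier_le (h : IsPosDefFun Φ) (hi : Integrable Φ) (r : ℝ) :
    ∫ w in closedBall (0 : V) r, (𝓕 (fun x => (Φ x : ℂ)) w).re ≤ Φ 0 := by
  have hc := Complex.continuous_re.comp (continuous_fourier_ofReal hi)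
  have hFb (w : V) : ‖(𝓕 (fun x => (Φ x : ℂ)) w).re‖ ≤ ∫ x, ‖(Φ x : ℂ)‖ :=
    (Complex.abs_re_le_norm _).trans (VectorFourier.norm_fourierIntegral_le_integral_norm _ _ _ _ _)
  -- On the ball the Gaussian is at least exp(-b r²), and the integrand outside is nonnegative; then
  -- b → 0.
  have key (b : ℝ) (hb : 0 < b) : Real.exp (-b * r ^ 2) *
      ∫ w in closedBall (0 : V) r, (𝓕 (fun x => (Φ x : ℂ)) w).re ≤ Φ 0 := by
    have hg : Integrable fun w => (𝓕 (fun x => (Φ x : ℂ)) w).re * Real.exp (-b * ‖w‖ ^ 2) :=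
      (integrable_exp_neg_mul_sq_norm hb).bdd_mul hc.aestronglyMeasurable
        (Filter.Eventually.of_forall hFb)
    refine le_trans ?_ (h.integral_re_fourier_mul_gaussian_le hi hb)
    rw [← integral_const_mul]
    refine le_trans ?_ (setIntegral_le_integral (s := closedBall (0 : V) r) hg
      (Filter.Eventually.of_forall fun w =>
        mul_nonneg (h.re_fourier_nonneg hi w) (Real.exp_pos _).le))
    refine setIntegral_mono_on ?_ hg.integrableOn measurableSet_closedBall fun w hw => ?_
    · exact ((by fun_prop : Continuous fun w =>
        Real.exp (-b * r ^ 2) * (𝓕 (fun x => (Φ x : ℂ)) w).re).continuousOn).integrableOn_compact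
          (isCompact_closedBall _ _)
    · rw [mul_comm]
      refine mul_le_mul_of_nonneg_left (Real.exp_le_exp.2 ?_) (h.re_fourier_nonneg hi w)
      have : ‖w‖ ^ 2 ≤ r ^ 2 := by
        have := mem_closedBall_zero_iff.1 hw
        gcongr
      nlinarith
  have hlim : Filter.Tendsto (fun n : ℕ => Real.exp (-(1 / ((n : ℝ) + 1)) * r ^ 2) *
      ∫ w in closedBall (0 : V) r, (𝓕 (fun x => (Φ x : ℂ)) w).re) Filter.atTop
      (nhds (Real.exp (-0 * r ^ 2) *
        ∫ w in closedBall (0 : V) r, (𝓕 (fun x => (Φ x : ℂ)) w).re)) :=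
    ((Real.continuous_exp.tendsto _).comp
      ((tendsto_one_div_add_atTop_nhds_zero_nat.neg).mul_const _)).mul_const _
  simp only [neg_zero, zero_mul, Real.exp_zero, one_mul] at hlim
  exact le_of_tendsto' hlim fun n => by simpa using key _ (by positivity : 0 < 1 / ((n : ℝ) + 1))

end IsPosDefFun

/-! ### Exponential sums and quadratic forms. -/

section ExpSum

variable {V : Type*} [NormedAddCommGroup V] [InnerProductSpace ℝ V] {ι : Type*} [Fintype ι]

/-- The exponential sum `∑ aᵢ exp(2πi⟪xᵢ, w⟫)`. -/
noncomputable def expSum (a : ι → ℝ) (x : ι → V) (w : V) : ℂ :=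
  ∑ i, (a i : ℂ) * (Real.fourierChar ⟪x i, w⟫ : ℂ)

theorem continuous_expSum (a : ι → ℝ) (x : ι → V) : Continuous (expSum a x) := by
  unfold expSum
  have := Real.continuous_fourierChar
  fun_prop

theorem expSum_smul (a : ι → ℝ) (x : ι → V) (t : ℝ) (w : V) :
    expSum a x (t • w) = expSum a (fun i => t • x i) w := by
  simp [expSum, inner_smul_left, inner_smul_right]

theorem sum_sum_fourierChar_eq_normSq_expSum (a : ι → ℝ) (x : ι → V) (w : V) :
    ∑ i, ∑ j, ((a i * a j : ℝ) : ℂ) * (Real.fourierChar ⟪x i - x j, w⟫ : ℂ) =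
      ((‖expSum a x w‖ ^ 2 : ℝ) : ℂ) := by
  push_cast
  rw [← Complex.mul_conj', expSum, map_sum, Finset.sum_mul_sum]
  refine Finset.sum_congr rfl fun i _ => Finset.sum_congr rfl fun j _ => ?_
  rw [inner_sub_left, sub_eq_add_neg, AddChar.map_add_eq_mul, AddChar.map_neg_eq_inv]
  simp only [Circle.coe_mul, Circle.coe_inv_eq_conj, map_mul, Complex.conj_ofReal]
  ring

variable [FiniteDimensional ℝ V] [MeasurableSpace V] [BorelSpace V]

/-- The Fourier transform of a linear combination of translates. -/
theorem fourier_sum_translate {f : V → ℝ} (hf : Integrable f) (a : ι → ℝ) (x : ι → V) (w : V) :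
    𝓕 (fun τ => ((∑ i, a i * f (x i + τ) : ℝ) : ℂ)) w =
      expSum a x w * 𝓕 (fun τ => (f τ : ℂ)) w := by
  have hi (i : ι) : Integrable fun τ =>
      Real.fourierChar (-⟪τ, w⟫) • ((a i : ℂ) * (f (x i + τ) : ℂ)) :=
    (Real.fourierIntegral_convergent_iff (f := fun τ => (a i : ℂ) * (f (x i + τ) : ℂ)) w).2
      ((hf.comp_add_left (x i)).ofReal.const_mul _)
  rw [Real.fourier_eq]
  push_cast
  simp_rw [Finset.smul_sum]
  rw [integral_finsetSum _ fun i _ => hi i, expSum, Finset.sum_mul]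
  refine Finset.sum_congr rfl fun i _ => ?_
  rw [Real.fourier_eq, ← integral_add_left_eq_self
    (fun τ => Real.fourierChar (-⟪τ, w⟫) • (f τ : ℂ)) (x i), ← integral_const_mul]
  refine integral_congr_ae (Filter.Eventually.of_forall fun τ => ?_)
  simp only [inner_add_left, neg_add, AddChar.map_add_eq_mul, Circle.smul_def, Circle.coe_mul,
    smul_eq_mul, AddChar.map_neg_eq_inv, Circle.coe_inv]
  have : (Real.fourierChar ⟪x i, w⟫ : ℂ) ≠ 0 := Circle.coe_ne_zero _
  field_simp

end ExpSum

theorem IsPosDefFun.setIntegral_re_fourier_mul_expSum_le {V : Type*} [NormedAddCommGroup V]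
    [InnerProductSpace ℝ V] [FiniteDimensional ℝ V] [MeasurableSpace V] [BorelSpace V] {Φ : V → ℝ}
    (h : IsPosDefFun Φ) (hi : Integrable Φ) {κ : Type} [Fintype κ] (a : κ → ℝ) (x : κ → V)
    (r : ℝ) :
    ∫ w in closedBall (0 : V) r, (𝓕 (fun x => (Φ x : ℂ)) w).re * ‖expSum a x w‖ ^ 2 ≤
      ∑ i, ∑ j, a i * a j * Φ (x i - x j) := by
  have h1 := (h.sum_sum a x).setIntegral_re_fourier_le
    (integrable_finsetSum _ fun i _ => integrable_finsetSum _ fun j _ =>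
      (hi.comp_add_left (x i - x j)).const_mul (a i * a j)) r
  simp only [add_zero] at h1
  refine le_of_eq_of_le (integral_congr_ae (Filter.Eventually.of_forall fun w => ?_)) h1
  have h2 := fourier_sum_translate hi (fun p : κ × κ => a p.1 * a p.2) (fun p => x p.1 - x p.2) w
  simp only [expSum, Fintype.sum_prod_type] at h2
  rw [sum_sum_fourierChar_eq_normSq_expSum] at h2
  simp only [h2, Complex.re_ofReal_mul]
  ring

/-! ### Test functions and the Ingham inequality. -/

theorem HasCompactSupport.sq {X : Type*} [TopologicalSpace X] {u : X → ℝ}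
    (hc : HasCompactSupport u) : HasCompactSupport fun x => u x ^ 2 := by
  simp_rw [pow_two]
  exact hc.mul_left

theorem HasCompactSupport.ofReal {X : Type*} [TopologicalSpace X] {u : X → ℝ}
    (hc : HasCompactSupport u) : HasCompactSupport fun x => (u x : ℂ) :=
  hc.comp_left (g := Complex.ofReal) Complex.ofReal_zero

theorem norm_gradient_sq_eq_sum {V : Type*} [NormedAddCommGroup V] [InnerProductSpace ℝ V]
    [CompleteSpace V] {κ : Type*} [Fintype κ] (b : OrthonormalBasis κ ℝ V) (u : V → ℝ)
    (x : V) : ‖gradient u x‖ ^ 2 = ∑ k, fderiv ℝ u x (b k) ^ 2 := by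
  rw [← b.sum_sq_norm_inner_left]
  refine Finset.sum_congr rfl fun k _ => ?_
  rw [← toDual_gradient, InnerProductSpace.toDual_apply_apply, Real.norm_eq_abs, sq_abs]

theorem integral_sq_pos_of_ne_zero {V : Type*} [NormedAddCommGroup V] [InnerProductSpace ℝ V]
    [FiniteDimensional ℝ V] [MeasurableSpace V] [BorelSpace V] {u : V → ℝ} (hu : Continuous u)
    (hc : HasCompactSupport u) (hu0 : u ≠ 0) : 0 < ∫ x, u x ^ 2 := by
  obtain ⟨x, hx⟩ := Function.ne_iff.1 hu0
  exact (hu.pow 2).integral_pos_of_hasCompactSupport_nonneg_nonzero hc.sq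
    (fun x => sq_nonneg _) (pow_ne_zero 2 hx)

section Ingham

variable {V : Type*} [NormedAddCommGroup V] [InnerProductSpace ℝ V] [FiniteDimensional ℝ V]
  [MeasurableSpace V] [BorelSpace V] {ι : Type*} [Fintype ι]

/-- Plancherel's theorem for a sum of translates with disjoint supports. -/
theorem integral_expSum_mul_fourier {v : V → ℝ} (hv : ContDiff ℝ (⊤ : ℕ∞) v)
    (hc : HasCompactSupport v) (hs : tsupport v ⊆ ball 0 (1 / 2)) (a : ι → ℝ) {y : ι → V}
    (hy : ∀ i j, i ≠ j → 1 ≤ ‖y i - y j‖) :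
    Integrable (fun w => ‖expSum a y w‖ ^ 2 * ‖𝓕 (fun x => (v x : ℂ)) w‖ ^ 2) ∧
    ∫ w, ‖expSum a y w‖ ^ 2 * ‖𝓕 (fun x => (v x : ℂ)) w‖ ^ 2 =
      (∑ i, a i ^ 2) * ∫ x, v x ^ 2 := by
  set U : V → ℝ := fun x => ∑ i, a i * v (y i + x) with hU
  have hUs : ContDiff ℝ (⊤ : ℕ∞) U := by fun_prop
  have hci (i : ι) : HasCompactSupport fun x => a i * v (y i + x) :=
    (hc.comp_homeomorph (Homeomorph.addLeft (y i))).mul_left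
  have hUc : HasCompactSupport U := by
    refine HasCompactSupport.intro
      (K := ⋃ i, tsupport fun x => a i * v (y i + x)) (isCompact_iUnion fun i => hci i) ?_
    intro x hx
    simp only [Set.mem_iUnion, not_exists] at hx
    exact Finset.sum_eq_zero fun i _ =>
      image_eq_zero_of_notMem_tsupport (f := fun x => a i * v (y i + x)) (hx i)
  have hvi : Integrable v := hv.continuous.integrable_of_hasCompactSupport hc
  have hv2 : Integrable fun x => v x ^ 2 :=
    (hv.continuous.pow 2).integrable_of_hasCompactSupport (hc.sq)
  set f : SchwartzMap V ℂ := HasCompactSupport.toSchwartzMap (f := fun x => (U x : ℂ))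
    (hUc.ofReal)
    (Complex.ofRealCLM.contDiff.comp hUs) with hf
  have hF (w : V) : ‖𝓕 f w‖ ^ 2 = ‖expSum a y w‖ ^ 2 * ‖𝓕 (fun x => (v x : ℂ)) w‖ ^ 2 := by
    rw [← mul_pow, ← norm_mul, ← fourier_sum_translate hvi]
    rfl
  have hP := f.integral_norm_sq_fourier
  have hI : Integrable fun w => ‖𝓕 f w‖ ^ 2 := ((𝓕 f).memLp 2).integrable_norm_pow (by norm_num)
  simp_rw [hF] at hP hI
  refine ⟨hI, hP.trans ?_⟩
  -- Distinct translates live in disjoint open balls of radius 1/2, so cross terms vanish.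
  have hpt (x : V) : ‖f x‖ ^ 2 = ∑ i, a i ^ 2 * v (y i + x) ^ 2 := by
    have h1 : ‖f x‖ ^ 2 = U x * U x := by
      change ‖(U x : ℂ)‖ ^ 2 = _
      rw [Complex.norm_real, Real.norm_eq_abs, sq_abs, sq]
    rw [h1, hU, Finset.sum_mul_sum]
    refine Finset.sum_congr rfl fun i _ => ?_
    rw [Finset.sum_eq_single i ?_ (by simp)]
    · ring
    · intro j _ hji
      have : v (y i + x) = 0 ∨ v (y j + x) = 0 := by
        by_contra! hne
        have h2 := mem_ball_zero_iff.1 (hs (subset_tsupport _ hne.1))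
        have h3 := mem_ball_zero_iff.1 (hs (subset_tsupport _ hne.2))
        have h4 := norm_sub_le (y i + x) (y j + x)
        rw [add_sub_add_right_eq_sub] at h4
        linarith [hy i j hji.symm]
      rcases this with h | h <;> simp [h]
  simp_rw [hpt]
  rw [integral_finsetSum _ fun i _ => (hv2.comp_add_left (y i)).const_mul _, Finset.sum_mul]
  refine Finset.sum_congr rfl fun i _ => ?_
  rw [integral_const_mul, integral_add_left_eq_self (fun x => v x ^ 2)]

/-- Differentiation becomes multiplication by 2πi⟪w, m⟫. Summed over an orthonormal basis this
yields the factor ‖2πw‖². -/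
theorem norm_fourier_fderiv_sq {u : V → ℝ} (hu : ContDiff ℝ (⊤ : ℕ∞) u)
    (hc : HasCompactSupport u) (m w : V) :
    ‖𝓕 (fun x => (fderiv ℝ u x m : ℂ)) w‖ ^ 2 =
      (2 * Real.pi) ^ 2 * ⟪w, m⟫ ^ 2 * ‖𝓕 (fun x => (u x : ℂ)) w‖ ^ 2 := by
  set f : SchwartzMap V ℂ := HasCompactSupport.toSchwartzMap (f := fun x => (u x : ℂ))
    (hc.ofReal) (Complex.ofRealCLM.contDiff.comp hu) with hf
  have h1 : (LineDeriv.lineDerivOp m f : V → ℂ) = fun x => (fderiv ℝ u x m : ℂ) := by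
    ext x
    rw [SchwartzMap.lineDerivOp_apply_eq_fderiv]
    have h2 : HasFDerivAt (fun x => (u x : ℂ)) (Complex.ofRealCLM.comp (fderiv ℝ u x)) x :=
      Complex.ofRealCLM.hasFDerivAt.comp x
        (hu.differentiable (by simp)).differentiableAt.hasFDerivAt
    have h3 : fderiv ℝ f x = Complex.ofRealCLM.comp (fderiv ℝ u x) := h2.fderiv
    rw [h3]
    simp
  have h4 := congrArg (fun g : SchwartzMap V ℂ => ‖g w‖ ^ 2) (SchwartzMap.fourier_lineDerivOp_eq f m)
  have htg : (inner ℝ · m : V → ℝ).HasTemperateGrowth := ((innerSL ℝ).flip m).hasTemperateGrowth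
  simp only [SchwartzMap.fourier_coe, h1, smul_apply,
    SchwartzMap.smulLeftCLM_apply_apply htg, norm_smul] at h4
  rw [h4]
  have h5 : (f : V → ℂ) = fun x => (u x : ℂ) := rfl
  rw [h5]
  simp [mul_pow, mul_assoc]

/-- Cauchy–Schwarz on a set of measure at most 1, obtained by expanding ∫ₛ (|u| - A)² ≥ 0. -/
theorem integral_abs_sq_le {u : V → ℝ} (hu : Continuous u) (hc : HasCompactSupport u)
    {s : Set V} (hs1 : volume.real s ≤ 1) (hfin : volume s ≠ ⊤)
    (hsu : ∀ x, x ∉ s → u x = 0) : (∫ x, |u x|) ^ 2 ≤ ∫ x, u x ^ 2 := by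
  set A := ∫ x, |u x|
  have hi1 : Integrable fun x => |u x| :=
    (hu.integrable_of_hasCompactSupport hc).abs
  have hi2 : Integrable fun x => u x ^ 2 :=
    (hu.pow 2).integrable_of_hasCompactSupport (hc.sq)
  have h0 : 0 ≤ ∫ x in s, (|u x| - A) ^ 2 := integral_nonneg fun x => sq_nonneg _
  have h1 : ∫ x in s, (|u x| - A) ^ 2 = ∫ x in s, (u x ^ 2 - 2 * A * |u x| + A ^ 2) :=
    integral_congr_ae (Filter.Eventually.of_forall fun x => by
      simp only [← sq_abs (u x)]; ring)
  have hs2 : IntegrableOn (fun x => u x ^ 2) s := hi2.integrableOn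
  have hs3 : IntegrableOn (fun x => 2 * A * |u x|) s := (hi1.const_mul _).integrableOn
  have hs4 : IntegrableOn (fun x => u x ^ 2 - 2 * A * |u x|) s := hs2.sub hs3
  rw [h1, integral_add hs4 (integrableOn_const hfin), integral_sub hs2 hs3,
    integral_const_mul, setIntegral_eq_integral_of_forall_compl_eq_zero fun x hx => by simp [hsu x hx],
    setIntegral_eq_integral_of_forall_compl_eq_zero fun x hx => by simp [hsu x hx],
    setIntegral_const, smul_eq_mul] at h0
  nlinarith [sq_nonneg A]

/-- An inequality of Ingham type: the mean square of an exponential sum with `1`-separated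
frequencies over a ball, for a test function `u` of Rayleigh quotient at most `3c²/4`. -/
theorem sum_sq_le_setIntegral_expSum {u : V → ℝ} (hu : ContDiff ℝ (⊤ : ℕ∞) u)
    (hc : HasCompactSupport u) (hs : tsupport u ⊆ ball 0 (1 / 2)) (hu0 : u ≠ 0)
    (hvol : volume.real (ball (0 : V) (1 / 2)) ≤ 1) {c : ℝ} (hc0 : 0 < c)
    (hR : ∫ x, ‖gradient u x‖ ^ 2 ≤ 3 / 4 * c ^ 2 * ∫ x, u x ^ 2) (a : ι → ℝ) {y : ι → V}
    (hy : ∀ i j, i ≠ j → 1 ≤ ‖y i - y j‖) :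
    (∑ i, a i ^ 2) / 4 ≤ ∫ w in closedBall (0 : V) (c / (2 * Real.pi)), ‖expSum a y w‖ ^ 2 := by
  set b := stdOrthonormalBasis ℝ V
  have hπ := Real.pi_pos
  have hpos : 0 < ∫ x, u x ^ 2 := integral_sq_pos_of_ne_zero hu.continuous hc hu0
  have hdu (k) : ContDiff ℝ (⊤ : ℕ∞) fun x => fderiv ℝ u x (b k) :=
    (hu.fderiv_right (m := (⊤ : ℕ∞)) (by simp)).clm_apply contDiff_const
  have hdc (k) : HasCompactSupport fun x => fderiv ℝ u x (b k) := hc.fderiv_apply ℝ _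
  have hds (k) : tsupport (fun x => fderiv ℝ u x (b k)) ⊆ ball 0 (1 / 2) :=
    (tsupport_fderiv_apply_subset ℝ (b k)).trans hs
  obtain ⟨hI0, hE0⟩ := integral_expSum_mul_fourier hu hc hs a hy
  have hk (k) := integral_expSum_mul_fourier (hdu k) (hdc k) (hds k) a hy
  have hgrad : ∫ x, ‖gradient u x‖ ^ 2 = ∑ k, ∫ x, fderiv ℝ u x (b k) ^ 2 := by
    simp_rw [norm_gradient_sq_eq_sum b]
    exact integral_finsetSum _ fun k _ => ((hdu k).continuous.pow 2).integrable_of_hasCompactSupport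
      ((hdc k).sq)
  set N : V → ℝ := fun w => ‖expSum a y w‖ ^ 2 with hN
  set G : V → ℝ := fun w => ‖𝓕 (fun x => (u x : ℂ)) w‖ ^ 2 with hG
  have hsum (w : V) : ∑ k, ‖expSum a y w‖ ^ 2 * ‖𝓕 (fun x => (fderiv ℝ u x (b k) : ℂ)) w‖ ^ 2 =
      N w * ((2 * Real.pi) ^ 2 * ‖w‖ ^ 2 * G w) := by
    simp_rw [norm_fourier_fderiv_sq hu hc, ← Finset.mul_sum, ← Finset.sum_mul, ← Finset.mul_sum]
    rw [← b.sum_sq_norm_inner_left w]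
    simp [hN, hG]
  have hI1 := integrable_finsetSum Finset.univ fun k _ => (hk k).1
  have hE1 : ∫ w, ∑ k, ‖expSum a y w‖ ^ 2 * ‖𝓕 (fun x => (fderiv ℝ u x (b k) : ℂ)) w‖ ^ 2 =
      (∑ i, a i ^ 2) * ∫ x, ‖gradient u x‖ ^ 2 := by
    rw [integral_finsetSum _ fun k _ => (hk k).1, hgrad, Finset.mul_sum]
    exact Finset.sum_congr rfl fun k _ => (hk k).2
  simp_rw [hsum] at hI1 hE1
  have hE : ∫ w, (c ^ 2 * (N w * G w) - N w * ((2 * Real.pi) ^ 2 * ‖w‖ ^ 2 * G w)) =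
      (∑ i, a i ^ 2) * (c ^ 2 * (∫ x, u x ^ 2) - ∫ x, ‖gradient u x‖ ^ 2) := by
    rw [integral_sub (hI0.const_mul _) hI1, integral_const_mul, hE0, hE1]
    ring
  have hGle (w : V) : G w ≤ ∫ x, u x ^ 2 := by
    refine le_trans ?_ (integral_abs_sq_le hu.continuous hc hvol
      measure_ball_lt_top.ne fun x hx =>
        image_eq_zero_of_notMem_tsupport fun h => hx (hs h))
    refine pow_le_pow_left₀ (norm_nonneg _) ?_ 2
    simpa using! VectorFourier.norm_fourierIntegral_le_integral_norm Real.fourierChar volume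
      (innerₗ V) (fun x => (u x : ℂ)) w
  have hNc : Continuous N := (continuous_expSum a y).norm.pow 2
  set B := closedBall (0 : V) (c / (2 * Real.pi)) with hB
  have hNi : IntegrableOn N B := hNc.continuousOn.integrableOn_compact (isCompact_closedBall _ _)
  -- The factor c² - ‖2πw‖² is negative off B. On B its negative part is dropped and G is bounded by
  -- its supremum.
  have hup : ∫ w, (c ^ 2 * (N w * G w) - N w * ((2 * Real.pi) ^ 2 * ‖w‖ ^ 2 * G w)) ≤
      (c ^ 2 * ∫ x, u x ^ 2) * ∫ w in B, N w := by
    rw [← integral_const_mul, ← integral_indicator measurableSet_closedBall]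
    refine integral_mono ((hI0.const_mul _).sub hI1)
      ((integrable_indicator_iff measurableSet_closedBall).2 (hNi.const_mul _)) fun w => ?_
    have hN0 : 0 ≤ N w := sq_nonneg _
    have hG0 : 0 ≤ G w := sq_nonneg _
    by_cases hw : w ∈ B
    · rw [Set.indicator_of_mem hw]
      have h1 : 0 ≤ N w * ((2 * Real.pi) ^ 2 * ‖w‖ ^ 2 * G w) := by positivity
      have h2 : N w * G w ≤ N w * ∫ x, u x ^ 2 := mul_le_mul_of_nonneg_left (hGle w) hN0
      nlinarith [sq_nonneg c]
    · rw [Set.indicator_of_notMem hw]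
      have h1 : c < 2 * Real.pi * ‖w‖ := by
        rw [hB, mem_closedBall_zero_iff, not_le, div_lt_iff₀ (by positivity)] at hw
        linarith
      have h2 : c ^ 2 ≤ (2 * Real.pi * ‖w‖) ^ 2 := by gcongr
      have h3 : 0 ≤ N w * G w := by positivity
      nlinarith
  rw [hE] at hup
  have hA : 0 ≤ ∑ i, a i ^ 2 := Finset.sum_nonneg fun i _ => sq_nonneg _
  have hcu : 0 < c ^ 2 * ∫ x, u x ^ 2 := by positivity
  -- By `hR` at least a quarter of c²∫u² survives the subtraction.
  refine le_of_mul_le_mul_left (le_trans ?_ hup) hcu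
  have := mul_le_mul_of_nonneg_left hR hA
  nlinarith

end Ingham

/-! ### Poincaré's inequality. -/

/-- **Poincaré's inequality** on the ball of radius `1/2`. -/
theorem integral_sq_le_integral_gradient_sq {V : Type*} [NormedAddCommGroup V]
    [InnerProductSpace ℝ V] [FiniteDimensional ℝ V] [Nontrivial V] [MeasurableSpace V]
    [BorelSpace V] {u : V → ℝ} (hu : ContDiff ℝ (⊤ : ℕ∞) u) (hc : HasCompactSupport u)
    (hs : tsupport u ⊆ ball 0 (1 / 2)) :
    ∫ x, u x ^ 2 ≤ ∫ x, ‖gradient u x‖ ^ 2 := by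
  obtain ⟨e, he⟩ := exists_norm_eq V zero_le_one
  have hd : Differentiable ℝ u := hu.differentiable (by simp)
  have hcu := hu.continuous
  have hcd : Continuous fun x => fderiv ℝ u x e := (hu.continuous_fderiv (by simp)).clm_apply
    continuous_const
  have hcg : Continuous (gradient u) :=
    (InnerProductSpace.toDual ℝ V).symm.continuous.comp (hu.continuous_fderiv (by simp))
  have hgs : HasCompactSupport fun x => ‖gradient u x‖ ^ 2 := by
    refine ((hc.fderiv ℝ).comp_left (g := fun L => ‖(InnerProductSpace.toDual ℝ V).symm L‖ ^ 2) ?_)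
    simp
  have hu2 : Integrable fun x => u x ^ 2 := (hcu.pow 2).integrable_of_hasCompactSupport hc.sq
  have hg2 : Integrable fun x => ‖gradient u x‖ ^ 2 :=
    (hcg.norm.pow 2).integrable_of_hasCompactSupport hgs
  have hlin (x : V) : fderiv ℝ (fun x => ⟪e, x⟫) x e = 1 := by
    have h1 : HasFDerivAt (fun x => ⟪e, x⟫) (innerSL ℝ e) x := (innerSL ℝ e).hasFDerivAt
    rw [h1.fderiv]
    simp [he]
  have hsq (x : V) : fderiv ℝ (fun x => u x ^ 2) x e = 2 * u x * fderiv ℝ u x e := by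
    rw [((hd x).hasFDerivAt.pow 2).fderiv]
    simp
  have hi3 : Integrable fun x => ⟪e, x⟫ * (2 * u x * fderiv ℝ u x e) :=
    (by fun_prop : Continuous fun x => ⟪e, x⟫ * (2 * u x * fderiv ℝ u x e))
      |>.integrable_of_hasCompactSupport (hc.mul_left (f := fun _ => (2 : ℝ))).mul_right.mul_left
  -- Since ⟪e, x⟫ has derivative 1 along e, parts give ∫u² = -∫⟪e, x⟫ 2u ∂ₑu. On the support |⟪e,
  -- x⟫| ≤ 1/2, and AM–GM absorbs half of ∫u².
  have hibp := integral_mul_fderiv_eq_neg_fderiv_mul_of_integrable (μ := (volume : Measure V))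
    (f := fun x => ⟪e, x⟫) (g := fun x => u x ^ 2) (v := e) (by simpa [hlin] using hu2)
    (by simpa [hsq] using hi3)
    ((by fun_prop : Continuous fun x => ⟪e, x⟫ * u x ^ 2).integrable_of_hasCompactSupport
      hc.sq.mul_left) (fun x _ => (innerSL ℝ e).differentiableAt) (fun x _ => (hd x).pow 2)
  simp only [hlin, hsq, one_mul] at hibp
  have hle : ∫ x, -(⟪e, x⟫ * (2 * u x * fderiv ℝ u x e)) ≤
      ∫ x, (u x ^ 2 / 2 + ‖gradient u x‖ ^ 2 / 2) := by
    refine integral_mono hi3.neg ((hu2.div_const 2).add (hg2.div_const 2)) fun x => ?_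
    by_cases hx : x ∈ tsupport u
    · have h1 := mem_ball_zero_iff.1 (hs hx)
      have h2 : |⟪e, x⟫| ≤ 1 / 2 := (abs_real_inner_le_norm e x).trans (by rw [he]; linarith)
      have h3 : |fderiv ℝ u x e| ≤ ‖gradient u x‖ := by
        rw [← toDual_gradient, InnerProductSpace.toDual_apply_apply]
        simpa [he] using abs_real_inner_le_norm (gradient u x) e
      calc -(⟪e, x⟫ * (2 * u x * fderiv ℝ u x e)) ≤ |⟪e, x⟫ * (2 * u x * fderiv ℝ u x e)| :=
            neg_le_abs _
        _ = |⟪e, x⟫| * (2 * |u x| * |fderiv ℝ u x e|) := by simp [abs_mul]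
        _ ≤ 1 / 2 * (2 * |u x| * ‖gradient u x‖) := by gcongr
        _ ≤ u x ^ 2 / 2 + ‖gradient u x‖ ^ 2 / 2 := by
            rw [← sq_abs (u x)]
            nlinarith [sq_nonneg (|u x| - ‖gradient u x‖)]
    · have : u x = 0 := image_eq_zero_of_notMem_tsupport hx
      simp only [this]
      simp
      positivity
  rw [integral_neg, hibp, neg_neg, integral_add (hu2.div_const 2) (hg2.div_const 2),
    integral_div, integral_div] at hle
  linarith

/-! ### The Dirichlet eigenvalue, scaling, and the bound for the quadratic form. -/

section Dirichlet

variable {d : ℕ}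

theorem exists_contDiff_tsupport_subset_ball (d : ℕ) :
    ∃ u : EuclideanSpace ℝ (Fin d) → ℝ, ContDiff ℝ (⊤ : ℕ∞) u ∧ HasCompactSupport u ∧
      tsupport u ⊆ ball (0 : EuclideanSpace ℝ (Fin d)) (1 / 2) ∧ u ≠ 0 := by
  obtain ⟨u, h1, h2, h3, -, h4⟩ := exists_contDiff_tsupport_subset (n := (⊤ : ℕ∞))
    (ball_mem_nhds (0 : EuclideanSpace ℝ (Fin d)) (by norm_num : (0 : ℝ) < 1 / 2))
  exact ⟨u, h3, h2, h1, fun h => by simp [h] at h4⟩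

/-- The value 1 is what Poincaré gives; only positivity matters later. -/
theorem one_le_dirichletEigenvalue (hd : 1 ≤ d) : 1 ≤ dirichletEigenvalue d := by
  have : Nonempty (Fin d) := ⟨⟨0, hd⟩⟩
  obtain ⟨u, h1, h2, h3, h4⟩ := exists_contDiff_tsupport_subset_ball d
  refine le_csInf ⟨_, u, h1, h2, h3, h4, rfl⟩ ?_
  rintro _ ⟨u, h1, h2, h3, h4, rfl⟩
  rw [one_le_div (integral_sq_pos_of_ne_zero h1.continuous h2 h4)]
  exact integral_sq_le_integral_gradient_sq h1 h2 h3

/-- Almost minimizers of the Rayleigh quotient. -/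
theorem exists_integral_gradient_sq_le {t : ℝ} (ht : dirichletEigenvalue d < t) :
    ∃ u : EuclideanSpace ℝ (Fin d) → ℝ, ContDiff ℝ (⊤ : ℕ∞) u ∧ HasCompactSupport u ∧
      tsupport u ⊆ ball (0 : EuclideanSpace ℝ (Fin d)) (1 / 2) ∧ u ≠ 0 ∧
      ∫ x, ‖gradient u x‖ ^ 2 ≤ t * ∫ x, u x ^ 2 := by
  obtain ⟨u, h1, h2, h3, h4⟩ := exists_contDiff_tsupport_subset_ball d
  by_contra! hcon
  refine ht.not_ge (le_csInf ⟨_, u, h1, h2, h3, h4, rfl⟩ ?_)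
  rintro _ ⟨u, h1, h2, h3, h4, rfl⟩
  exact ((lt_div_iff₀ (integral_sq_pos_of_ne_zero h1.continuous h2 h4)).2
    (hcon u h1 h2 h3 h4)).le

/-- The ball lies in a cube of side 1. -/
theorem volume_real_ball_half_le_one (d : ℕ) :
    volume.real (ball (0 : EuclideanSpace ℝ (Fin d)) (1 / 2)) ≤ 1 := by
  have hmp := EuclideanSpace.volume_preserving_symm_measurableEquiv_toLp (Fin d)
  set s : Set (Fin d → ℝ) := closedBall 0 (1 / 2)
  have hs : volume s = 1 := by
    rw [Real.volume_pi_closedBall _ (by norm_num)]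
    norm_num
  have hle : volume (ball (0 : EuclideanSpace ℝ (Fin d)) (1 / 2)) ≤ volume s := by
    rw [← hmp.measure_preimage measurableSet_closedBall.nullMeasurableSet]
    refine measure_mono fun x hx => ?_
    rw [mem_ball_zero_iff] at hx
    simp only [Set.mem_preimage, mem_closedBall_zero_iff]
    refine (pi_norm_le_iff_of_nonneg (by norm_num)).2 fun i => ?_
    exact (PiLp.norm_apply_le x i).trans hx.le
  rw [hs] at hle
  exact ENNReal.toReal_mono ENNReal.one_ne_top hle

theorem constZero_sq (hd : 1 ≤ d) : constZero d ^ 2 = 2 * dirichletEigenvalue d := by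
  have := one_le_dirichletEigenvalue hd
  rw [constZero, mul_pow, Real.sq_sqrt (by norm_num), Real.sq_sqrt (by linarith)]

theorem constZero_pos (hd : 1 ≤ d) : 0 < constZero d := by
  have := one_le_dirichletEigenvalue hd
  unfold constZero
  positivity

theorem constOne_pos (hd : 1 ≤ d) : 0 < constOne d := by
  have := one_le_dirichletEigenvalue hd
  have := Real.pi_pos
  unfold constOne
  positivity

/-- All powers of λ and π cancel, so the constant is the same in every dimension. -/
theorem constZero_pow_mul_constOne (hd : 1 ≤ d) :
    constZero d ^ d * constOne d / (2 * Real.pi) ^ ((d : ℝ) / 2) = 1 / 2 := by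
  have h1 := one_le_dirichletEigenvalue hd
  have hπ := Real.pi_pos
  have h2 : constZero d ^ d = (2 * dirichletEigenvalue d) ^ ((d : ℝ) / 2) := by
    rw [← constZero_sq hd, ← Real.rpow_natCast_mul (constZero_pos hd).le, ← Real.rpow_natCast]
    congr 1
    push_cast
    ring
  rw [h2, constOne, Real.mul_rpow (by norm_num) (by linarith),
    Real.mul_rpow (by norm_num) hπ.le]
  have : 0 < dirichletEigenvalue d ^ ((d : ℝ) / 2) := by positivity
  have : 0 < Real.pi ^ ((d : ℝ) / 2) := by positivity
  have : (0 : ℝ) < 2 ^ ((d : ℝ) / 2) := by positivity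
  field_simp

/-- Exponential sums with `q`-separated frequencies. -/
theorem sum_sq_le_setIntegral_expSum_of_separated (hd : 1 ≤ d) {ι : Type*} [Fintype ι]
    (a : ι → ℝ) {x : ι → EuclideanSpace ℝ (Fin d)} {q : ℝ} (hq : 0 < q)
    (hx : ∀ i j, i ≠ j → q ≤ ‖x i - x j‖) :
    (∑ i, a i ^ 2) / 4 * (q ^ d)⁻¹ ≤
      ∫ w in closedBall (0 : EuclideanSpace ℝ (Fin d)) (constZero d / q / (2 * Real.pi)),
        ‖expSum a x w‖ ^ 2 := by
  have h1 := one_le_dirichletEigenvalue hd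
  have hπ := Real.pi_pos
  -- Here t = 3λ/2 > λ, so an almost minimizer suffices and no eigenfunction is needed.
  obtain ⟨u, hu, hc, hs, hu0, hR⟩ := exists_integral_gradient_sq_le
    (d := d) (t := 3 / 4 * constZero d ^ 2) (by rw [constZero_sq hd]; linarith)
  have h2 := sum_sq_le_setIntegral_expSum hu hc hs hu0 (volume_real_ball_half_le_one d)
    (constZero_pos hd) hR a (y := fun i => q⁻¹ • x i) fun i j hij => by
      rw [← smul_sub, norm_smul, Real.norm_of_nonneg (by positivity), ← div_eq_inv_mul,
        one_le_div hq]
      exact hx i j hij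
  -- Scaling the nodes by q⁻¹ amounts to scaling w: the radius becomes c₀/(2πq) and the Jacobian
  -- supplies the power of q.
  simp_rw [← expSum_smul] at h2
  rw [Measure.setIntegral_comp_smul_of_pos volume (fun w => ‖expSum a x w‖ ^ 2) _
    (inv_pos.2 hq), _root_.smul_closedBall _ _ (by have := constZero_pos hd; positivity), smul_zero,
    Real.norm_of_nonneg (by positivity), finrank_euclideanSpace_fin, smul_eq_mul, inv_pow,
    inv_inv] at h2
  rw [← div_eq_mul_inv, div_le_iff₀ (by positivity), mul_comm]
  convert! h2 using 4
  field_simp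

theorem unitaryFourier_eq_fourier (Φ : EuclideanSpace ℝ (Fin d) → ℝ)
    (ξ : EuclideanSpace ℝ (Fin d)) :
    unitaryFourier Φ ξ = (((2 * Real.pi) ^ (-(d : ℝ) / 2) : ℝ) : ℂ) *
      𝓕 (fun x => (Φ x : ℂ)) ((2 * Real.pi)⁻¹ • ξ) := by
  rw [unitaryFourier, Real.fourier_eq]
  congr 1
  refine integral_congr_ae (Filter.Eventually.of_forall fun x => ?_)
  simp only [Circle.smul_def, Real.fourierChar_apply, smul_eq_mul, inner_smul_right]
  rw [mul_comm, real_inner_comm]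
  congr 2
  push_cast
  have : (Real.pi : ℂ) ≠ 0 := by exact_mod_cast Real.pi_ne_zero
  field_simp

variable {Φ : EuclideanSpace ℝ (Fin d) → ℝ}

theorem IsPosDefFun.re_unitaryFourier_nonneg (h : IsPosDefFun Φ) (hi : Integrable Φ)
    (ξ : EuclideanSpace ℝ (Fin d)) : 0 ≤ (unitaryFourier Φ ξ).re := by
  rw [unitaryFourier_eq_fourier, Complex.re_ofReal_mul]
  exact mul_nonneg (by have := Real.pi_pos; positivity) (h.re_fourier_nonneg hi _)

theorem IsPosDefFun.minFourierOnBall_nonneg (h : IsPosDefFun Φ) (hi : Integrable Φ) (r : ℝ) :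
    0 ≤ minFourierOnBall Φ r :=
  Real.sInf_nonneg (by
    rintro _ ⟨ξ, -, rfl⟩
    exact h.re_unitaryFourier_nonneg hi ξ)

theorem IsPosDefFun.minFourierOnBall_le_re_fourier (h : IsPosDefFun Φ) (hi : Integrable Φ)
    {r : ℝ} {w : EuclideanSpace ℝ (Fin d)} (hw : w ∈ closedBall 0 (r / (2 * Real.pi))) :
    (2 * Real.pi) ^ ((d : ℝ) / 2) * minFourierOnBall Φ r ≤ (𝓕 (fun x => (Φ x : ℂ)) w).re := by
  have hπ := Real.pi_pos
  have hmem : (2 * Real.pi) • w ∈ closedBall (0 : EuclideanSpace ℝ (Fin d)) r := by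
    rw [mem_closedBall_zero_iff, le_div_iff₀ (by positivity)] at hw
    rw [mem_closedBall_zero_iff, norm_smul, Real.norm_of_nonneg (by positivity)]
    linarith
  have h1 : minFourierOnBall Φ r ≤ (unitaryFourier Φ ((2 * Real.pi) • w)).re :=
    csInf_le ⟨0, by rintro _ ⟨ξ, -, rfl⟩; exact h.re_unitaryFourier_nonneg hi ξ⟩ ⟨_, hmem, rfl⟩
  rw [unitaryFourier_eq_fourier, Complex.re_ofReal_mul, smul_smul,
    inv_mul_cancel₀ (by positivity), one_smul, neg_div, Real.rpow_neg (by positivity),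
    ← div_eq_inv_mul, le_div_iff₀ (by positivity)] at h1
  linarith

/-- The lower bound for the quadratic form of a kernel matrix with `q`-separated nodes. -/
theorem IsPosDefFun.minFourierOnBall_mul_sum_sq_le (hd : 1 ≤ d) (h : IsPosDefFun Φ)
    (hi : Integrable Φ) {κ : Type} [Fintype κ] (a : κ → ℝ) {x : κ → EuclideanSpace ℝ (Fin d)}
    {q : ℝ} (hq : 0 < q) (hx : ∀ i j, i ≠ j → q ≤ ‖x i - x j‖) :
    1 / 2 * minFourierOnBall Φ (constZero d / q) * (q ^ d)⁻¹ * ∑ i, a i ^ 2 ≤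
      ∑ i, ∑ j, a i * a j * Φ (x i - x j) := by
  have hπ := Real.pi_pos
  set m := minFourierOnBall Φ (constZero d / q)
  have hm : 0 ≤ m := h.minFourierOnBall_nonneg hi _
  refine le_trans ?_ (h.setIntegral_re_fourier_mul_expSum_le hi a x (constZero d / q / (2 * Real.pi)))
  have hP := continuous_expSum a x
  have hF := Complex.continuous_re.comp (IsPosDefFun.continuous_fourier_ofReal hi)
  -- The normalization factor (2π)^(d/2) ≥ 2, valid as d ≥ 1, raises Ingham's 1/4 to the required
  -- 1/2; this uses m ≥ 0.
  have h2 : (2 : ℝ) ≤ (2 * Real.pi) ^ ((d : ℝ) / 2) := by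
    have h4 : (4 : ℝ) ≤ 2 * Real.pi := by linarith [Real.pi_gt_three]
    have hd' : (1 : ℝ) / 2 ≤ d / 2 := by
      have : (1 : ℝ) ≤ d := by exact_mod_cast hd
      linarith
    calc (2 : ℝ) = √4 := by
          rw [show (4 : ℝ) = 2 ^ 2 by norm_num, Real.sqrt_sq (by norm_num)]
      _ ≤ √(2 * Real.pi) := Real.sqrt_le_sqrt h4
      _ = (2 * Real.pi) ^ ((1 : ℝ) / 2) := Real.sqrt_eq_rpow _
      _ ≤ _ := Real.rpow_le_rpow_of_exponent_le (by linarith) hd'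
  have h3 : ∫ w in closedBall (0 : EuclideanSpace ℝ (Fin d)) (constZero d / q / (2 * Real.pi)),
      (2 * Real.pi) ^ ((d : ℝ) / 2) * m * ‖expSum a x w‖ ^ 2 ≤
      ∫ w in closedBall (0 : EuclideanSpace ℝ (Fin d)) (constZero d / q / (2 * Real.pi)),
        (𝓕 (fun x => (Φ x : ℂ)) w).re * ‖expSum a x w‖ ^ 2 := by
    refine setIntegral_mono_on ?_ ?_ measurableSet_closedBall fun w hw => ?_
    · exact (by fun_prop : Continuous fun w => (2 * Real.pi) ^ ((d : ℝ) / 2) * m *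
        ‖expSum a x w‖ ^ 2).continuousOn.integrableOn_compact (isCompact_closedBall _ _)
    · exact (hF.mul (hP.norm.pow 2)).continuousOn.integrableOn_compact (isCompact_closedBall _ _)
    · exact mul_le_mul_of_nonneg_right (h.minFourierOnBall_le_re_fourier hi hw) (sq_nonneg _)
  refine le_trans ?_ h3
  rw [integral_const_mul]
  have h4 := sum_sq_le_setIntegral_expSum_of_separated hd a hq hx
  have hS : 0 ≤ (∑ i, a i ^ 2) / 4 * (q ^ d)⁻¹ :=
    mul_nonneg (div_nonneg (Finset.sum_nonneg fun i _ => sq_nonneg _) (by norm_num))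
      (by positivity)
  calc _ = 2 * m * ((∑ i, a i ^ 2) / 4 * (q ^ d)⁻¹) := by ring
    _ ≤ (2 * Real.pi) ^ ((d : ℝ) / 2) * m * ((∑ i, a i ^ 2) / 4 * (q ^ d)⁻¹) := by gcongr
    _ ≤ _ := by gcongr

end Dirichlet

/-! ### From the quadratic form to the smallest eigenvalue. -/

/-- A lower bound for the quadratic form bounds the smallest eigenvalue of a symmetric matrix. -/
theorem le_lambdaMin {ι : Type*} [Fintype ι] [DecidableEq ι] [Nonempty ι] {A : Matrix ι ι ℝ}
    (hA : A.IsHermitian) {L : ℝ}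
    (h : ∀ a : ι → ℝ, L * ∑ i, a i ^ 2 ≤ ∑ i, ∑ j, a i * a j * A i j) : L ≤ lambdaMin A := by
  refine le_csInf ?_ ?_
  -- The infimum is meaningful only if a real eigenvalue exists; the spectral theorem supplies one.
  · obtain ⟨i⟩ := ‹Nonempty ι›
    refine ⟨hA.eigenvalues i, Module.End.hasEigenvalue_of_hasEigenvector
      (x := (hA.eigenvectorBasis i).ofLp) ⟨?_, ?_⟩⟩
    · rw [Module.End.mem_eigenspace_iff, Matrix.toLin'_apply, hA.mulVec_eigenvectorBasis]
    · intro h0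
      exact hA.eigenvectorBasis.orthonormal.ne_zero i (WithLp.ofLp_injective 2 h0)
  · intro μ hμ
    obtain ⟨a, ha⟩ := hμ.exists_hasEigenvector
    have h1 : A.mulVec a = μ • a := by
      simpa [Matrix.toLin'_apply] using ha.apply_eq_smul
    have h2 : ∑ i, ∑ j, a i * a j * A i j = μ * ∑ i, a i ^ 2 := by
      rw [Finset.mul_sum]
      refine Finset.sum_congr rfl fun i _ => ?_
      have h3 := congrFun h1 i
      simp only [Matrix.mulVec, dotProduct, Pi.smul_apply, smul_eq_mul] at h3
      rw [show μ * a i ^ 2 = a i * (μ * a i) by ring, ← h3, Finset.mul_sum]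
      exact Finset.sum_congr rfl fun j _ => by ring
    have hpos : 0 < ∑ i, a i ^ 2 := by
      obtain ⟨i, hi⟩ := Function.ne_iff.1 ha.2
      exact Finset.sum_pos' (fun i _ => sq_nonneg _)
        ⟨i, Finset.mem_univ _, by have : a i ≠ 0 := hi; positivity⟩
    have h3 := h a
    rw [h2] at h3
    exact le_of_mul_le_mul_right h3 hpos

theorem mainTheorem3 (d : ℕ) (hd : 1 ≤ d) :
    0 < constZero d ∧ 0 < constOne d ∧
    ∀ Φ : EuclideanSpace ℝ (Fin d) → ℝ,
      Integrable Φ volume →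
      IsPosDefKernel (translationKernel Φ) →
      ∀ X : Finset (EuclideanSpace ℝ (Fin d)), 2 ≤ X.card →
        constZero d ^ d * constOne d / (2 * Real.pi) ^ ((d : ℝ) / 2)
            * minFourierOnBall Φ (constZero d / Set.infsep (X : Set (EuclideanSpace ℝ (Fin d))))
            * (Set.infsep (X : Set (EuclideanSpace ℝ (Fin d))) ^ d)⁻¹
          ≤ lambdaMin (kernelMatrix (translationKernel Φ) X) := by
  refine ⟨constZero_pos hd, constOne_pos hd, fun Φ hi hΦ X hX => ?_⟩
  have hnt : (X : Set (EuclideanSpace ℝ (Fin d))).Nontrivial :=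
    Finset.one_lt_card_iff_nontrivial.1 hX
  -- `Set.infsep` defaults to 0 when the extended separation is infinite; two distinct points rule
  -- this out, and finiteness of X makes the separation positive.
  have hq : 0 < Set.infsep (X : Set (EuclideanSpace ℝ (Fin d))) :=
    Set.infsep_pos.2 ⟨X.finite_toSet.einfsep_pos, hnt.einfsep_lt_top⟩
  have : Nonempty X := hnt.nonempty.to_subtype
  rw [constZero_pow_mul_constOne hd]
  refine le_lambdaMin (hΦ X).isHermitian fun a => ?_
  exact hΦ.isPosDefFun.minFourierOnBall_mul_sum_sq_le hd hi a (x := fun i : X => i) hq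
    fun i j hij => by
      rw [← dist_eq_norm]
      exact Set.infsep_le_dist_of_mem i.2 j.2 fun h => hij (Subtype.ext h)
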